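/- Let $\mathcal{B}$ and $\mathcal{A}$ be unital complex Banach algebras and let $(\mathcal{A},\mathbb{E},\varepsilon)$ be a Banach $\mathcal{B}$-$\mathcal{B}$-non-commutative probability space: $\varepsilon:\mathcal{B}\otimes\mathcal{B}^{\mathrm{op}}\to\mathcal{A}$ is a unital homomorphism, $L_b:=\varepsilon(b\otimes 1)$ and $R_b:=\varepsilon(1\otimes b)$ depend injectively and boundedly on $b$, and $\mathbb{E}:\mathcal{A}\to\mathcal{B}$ is a bounded unital linear map with $\mathbb{E}(L_{b_1}R_{b_2}Z)=b_1\mathbb{E}(Z)b_2$ and $\mathbb{E}(ZL_b)=\mathbb{E}(ZR_b)$ for all $b,b_1,b_2\in\mathcal{B}$, $Z\in\mathcal{A}$. Let $Z_\ell\in\mathcal{A}$ commute with every $R_b$ and $Z_r\in\mathcal{A}$ commute with every $L_b$. For $n\ge 1$ and $\chi:\{1,\dots,n\}\to\{\ell,r\}$ let $\prec_\chi$ be the total order on $\{1,\dots,n\}$ that lists first $\chi^{-1}(\ell)$ in increasing order and then $\chi^{-1}(r)$ in decreasing order, and let $\mathcal{BI}(\chi)$ be the lattice (under refinement) of the partitions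 of $\{1,\dots,n\}$ all of whose blocks are intervals for $\prec_\chi$, with largest element $1_\chi$ and Möbius function $\mu_{\mathcal{BI}}$. For $\sigma\in\mathcal{BI}(\chi)$ with blocks $V_1,\dots,V_m$ listed in $\prec_\chi$-increasing order, the operator-valued moment function is $\mathcal{E}_\sigma(Z_1,\dots,Z_n)=\mathbb{E}(Z_{V_1})\cdots\mathbb{E}(Z_{V_m})$, where $Z_V=Z_{j_1}\cdots Z_{j_s}$ for $V=\{j_1<\dots<j_s\}$; the operator-valued bi-Boolean cumulants are $B_\pi(Z_1,\dots,Z_n)=\sum_{\sigma\in\mathcal{BI}(\chi),\,\sigma\le\pi}\mathcal{E}_\sigma(Z_1,\dots,Z_n)\,\mu_{\mathcal{BI}}(\sigma,\pi)$. Let $\chi_{m,n}$ be the map on $\{1,\dots,m+n\}$ equal to $\ell$ on the first $m$ and $r$ on the last $n$ indices. For $b,d\in\mathcal{B}$ put \[M^\ell_{Z_\ell}(b)=1+\sum_{m\ge1}\mathbb{E}((L_bZ_\ell)^m),\qquad M^r_{Z_r}(d)=1+\sum_{n\ge1}\mathbb{E}((R_dZ_r)^n),\] \[M_{(Z_\ell,Z_r)}(b,d)=1+\sum_{m,n\ge0,\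 m+n\ge1}\mathbb{E}((L_bZ_\ell)^m(R_dZ_r)^n),\] \[\eta^\ell_{Z_\ell}(b)=\sum_{m\ge1}B_{1_{\chi_{m,0}}}(L_bZ_\ell,\dots,L_bZ_\ell),\qquad \eta^r_{Z_r}(d)=\sum_{n\ge1}B_{1_{\chi_{0,n}}}(R_dZ_r,\dots,R_dZ_r),\] \[\eta_{(Z_\ell,Z_r)}(b,d)=\sum_{m,n\ge0,\ m+n\ge1}B_{1_{\chi_{m,n}}}(\underbrace{L_bZ_\ell,\dots,L_bZ_\ell}_{m},\underbrace{R_dZ_r,\dots,R_dZ_r}_{n}).\] Then there is $\delta>0$ such that for all $b,d\in\mathcal{B}$ with $\|b\|<\delta$ and $\|d\|<\delta$ all six series converge absolutely, $M^\ell_{Z_\ell}(b)$ and $M^r_{Z_r}(d)$ are invertible in $\mathcal{B}$, and \[\eta_{(Z_\ell,Z_r)}(b,d)=\eta^\ell_{Z_\ell}(b)+\eta^r_{Z_r}(d)+M^\ell_{Z_\ell}(b)^{-1}\,M_{(Z_\ell,Z_r)}(b,d)\,M^r_{Z_r}(d)^{-1}-1.\] -/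

import Mathlib

open scoped TensorProduct

/-- The two labels `ℓ` and `r`. -/
inductive Side : Type where
  | left : Side
  | right : Side
  deriving DecidableEq

/-! ### The order `≺_χ` and bi-interval partitions -/

section Combinatorics

variable {n : ℕ}

/-- The strict order `≺_χ` on `{1, …, n}`: first the left indices in increasing order, then the
right indices in decreasing order. -/
def chiLT (χ : Fin n → Side) (i j : Fin n) : Prop :=
  match χ i, χ j with
  | Side.left, Side.left => i < j
  | Side.left, Side.right => True
  | Side.right, Side.left => False
  | Side.right, Side.right => j < i

instance chiLT.instDecidable (χ : Fin n → Side) (i j : Fin n) : Decidable (chiLT χ i j) := by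
  unfold chiLT
  split <;> infer_instance

/-- The list `i₁ ≺_χ ⋯ ≺_χ iₙ` of all indices in `≺_χ`-increasing order. -/
def chiList (χ : Fin n → Side) : List (Fin n) :=
  (List.finRange n).filter (fun i => χ i = Side.left) ++
    ((List.finRange n).filter (fun i => χ i = Side.right)).reverse

/-- `V` is a `χ`-interval, i.e. an interval with respect to `≺_χ`. -/
def IsChiInterval (χ : Fin n → Side) (V : Finset (Fin n)) : Prop :=
  ∀ i ∈ V, ∀ k ∈ V, ∀ j, chiLT χ i j → chiLT χ j k → j ∈ V

/-- `i = min_{≺_χ}(V)`. -/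
def IsChiMin (χ : Fin n → Side) (V : Finset (Fin n)) (i : Fin n) : Prop :=
  i ∈ V ∧ ∀ j ∈ V, j = i ∨ chiLT χ i j

instance IsChiMin.instDecidable (χ : Fin n → Side) (V : Finset (Fin n)) (i : Fin n) :
    Decidable (IsChiMin χ V i) := by
  unfold IsChiMin
  infer_instance

/-- `BI(χ)`: the partitions of `{1, …, n}` all of whose blocks are `χ`-intervals, ordered by
refinement (such a partition is automatically non-crossing with respect to `≺_χ`). -/
abbrev BiInterval (χ : Fin n → Side) : Type :=
  {π : Finpartition (Finset.univ : Finset (Fin n)) // ∀ V ∈ π.parts, IsChiInterval χ V}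

noncomputable instance BiInterval.instFintype (χ : Fin n → Side) : Fintype (BiInterval χ) := by
  classical
  infer_instance

open Classical in
noncomputable instance BiInterval.instLocallyFiniteOrder (χ : Fin n → Side) :
    LocallyFiniteOrder (BiInterval χ) :=
  Fintype.toLocallyFiniteOrder

/-- The one-block partition `1_χ` (for `n ≥ 1`). -/
def BiInterval.one (χ : Fin n → Side) : BiInterval χ :=
  ⟨⊤, fun V hV => by
    have h : V = Finset.univ := by
      simpa using Finpartition.parts_top_subset (Finset.univ : Finset (Fin n)) hV
    intro i _ k _ j _ _
    rw [h]
    exact Finset.mem_univ j⟩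

open Classical in
/-- The Möbius function `μ_{BI}` of the lattice `BI(χ)`. -/
noncomputable def muBI (χ : Fin n → Side) (σ π : BiInterval χ) : ℂ :=
  IncidenceAlgebra.mu ℂ σ π

/-- `χ_{m,n}`: the first `m` indices are left, the last `n` indices are right. -/
def chiMN (m n : ℕ) : Fin (m + n) → Side :=
  fun k => if (k : ℕ) < m then Side.left else Side.right

/-- The tuple `(x, …, x, y, …, y)` with `m` entries `x` followed by `n` entries `y`. -/
def tupleMN {A : Type*} (m n : ℕ) (x y : A) : Fin (m + n) → A :=
  fun k => if (k : ℕ) < m then x else y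

end Combinatorics

/-! ### `B`-`B`-non-commutative probability spaces -/

/-- A `B`-`B`-non-commutative probability space `(A, E, ε)`. -/
structure BBProbSpace (A B : Type*) [Ring A] [Algebra ℂ A] [Ring B] [Algebra ℂ B] where
  /-- the unital homomorphism `ε : B ⊗ Bᵒᵖ → A` -/
  ε : (B ⊗[ℂ] Bᵐᵒᵖ) →ₐ[ℂ] A
  /-- the unital linear map `E : A → B` -/
  E : A →ₗ[ℂ] B
  injective_left : Function.Injective fun b : B => ε (b ⊗ₜ[ℂ] (1 : Bᵐᵒᵖ))
  injective_right : Function.Injective fun b : B => ε ((1 : B) ⊗ₜ[ℂ] MulOpposite.op b)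
  E_one : E 1 = 1
  E_ε_mul : ∀ (b₁ b₂ : B) (Z : A), E (ε (b₁ ⊗ₜ[ℂ] MulOpposite.op b₂) * Z) = b₁ * E Z * b₂
  E_mul_ε : ∀ (b : B) (Z : A),
    E (Z * ε (b ⊗ₜ[ℂ] (1 : Bᵐᵒᵖ))) = E (Z * ε ((1 : B) ⊗ₜ[ℂ] MulOpposite.op b))

namespace BBProbSpace

variable {A B : Type*} [Ring A] [Algebra ℂ A] [Ring B] [Algebra ℂ B]

/-- The left `B`-operator `L_b = ε(b ⊗ 1)`. -/
def L (P : BBProbSpace A B) (b : B) : A := P.ε (b ⊗ₜ[ℂ] (1 : Bᵐᵒᵖ))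

/-- The right `B`-operator `R_b = ε(1 ⊗ b)`. -/
def R (P : BBProbSpace A B) (b : B) : A := P.ε ((1 : B) ⊗ₜ[ℂ] MulOpposite.op b)

/-- The left algebra `A_ℓ`: the commutant of the right `B`-operators. -/
def leftAlg (P : BBProbSpace A B) : Subalgebra ℂ A := Subalgebra.centralizer ℂ (Set.range P.R)

/-- The right algebra `A_r`: the commutant of the left `B`-operators. -/
def rightAlg (P : BBProbSpace A B) : Subalgebra ℂ A := Subalgebra.centralizer ℂ (Set.range P.L)

/-- The moment `E(Z_{j₁} ⋯ Z_{j_s})` of a block `V = {j₁ < ⋯ < j_s}`, i.e. the value of the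
moment function on the full partition of `V`. -/
def blockMoment (P : BBProbSpace A B) {n : ℕ} (Z : Fin n → A) (V : Finset (Fin n)) : B :=
  P.E ((((List.finRange n).filter (fun j => j ∈ V)).map Z).prod)

/-- The operator-valued bi-free moment function `𝓔_π(Z₁, …, Zₙ)` on bi-interval partitions.
If `V₁, …, V_m` are the blocks of `π` in `≺_χ`-increasing order, bi-multiplicativity of `𝓔` gives
`𝓔_π(Z) = 𝓔_{π|V₁}(Z|V₁) ⋯ 𝓔_{π|V_m}(Z|V_m)`, where each `π|V_k` is a full partition, on which
`𝓔` is the expectation of the product. The blocks are enumerated through their `≺_χ`-minima. -/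
def momentFn (P : BBProbSpace A B) {n : ℕ} (χ : Fin n → Side) (π : BiInterval χ)
    (Z : Fin n → A) : B :=
  (((chiList χ).filter (fun i => IsChiMin χ (π.1.part i) i)).map
    (fun i => P.blockMoment Z (π.1.part i))).prod

open Classical in
/-- The operator-valued bi-Boolean cumulant function
`B_π(Z₁, …, Zₙ) = ∑_{σ ∈ BI(χ), σ ≤ π} 𝓔_σ(Z₁, …, Zₙ) μ_{BI}(σ, π)`. -/
noncomputable def cumulant (P : BBProbSpace A B) {n : ℕ} (χ : Fin n → Side) (π : BiInterval χ)
    (Z : Fin n → A) : B :=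
  ∑ σ : BiInterval χ with σ ≤ π, muBI χ σ π • P.momentFn χ σ Z

/-! ### The terms of the moment series and of the η-transforms -/

/-- `E((L_b Z_ℓ)^m)` -/
def momentLeft (P : BBProbSpace A B) (Zl : A) (b : B) (m : ℕ) : B := P.E ((P.L b * Zl) ^ m)

/-- `E((R_d Z_r)^n)` -/
def momentRight (P : BBProbSpace A B) (Zr : A) (d : B) (n : ℕ) : B := P.E ((P.R d * Zr) ^ n)

/-- `E((L_b Z_ℓ)^m (R_d Z_r)^n)` -/
def momentPair (P : BBProbSpace A B) (Zl Zr : A) (b d : B) (m n : ℕ) : B :=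
  P.E ((P.L b * Zl) ^ m * (P.R d * Zr) ^ n)

/-- `B_{1_{χ_{m,0}}}(L_b Z_ℓ, …, L_b Z_ℓ)` -/
noncomputable def cumulantLeft (P : BBProbSpace A B) (Zl : A) (b : B) (m : ℕ) : B :=
  P.cumulant (chiMN m 0) (BiInterval.one _) (fun _ => P.L b * Zl)

/-- `B_{1_{χ_{0,n}}}(R_d Z_r, …, R_d Z_r)` -/
noncomputable def cumulantRight (P : BBProbSpace A B) (Zr : A) (d : B) (n : ℕ) : B :=
  P.cumulant (chiMN 0 n) (BiInterval.one _) (fun _ => P.R d * Zr)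

/-- `B_{1_{χ_{m,n}}}(L_b Z_ℓ, …, L_b Z_ℓ, R_d Z_r, …, R_d Z_r)` -/
noncomputable def cumulantPair (P : BBProbSpace A B) (Zl Zr : A) (b d : B) (m n : ℕ) : B :=
  P.cumulant (chiMN m n) (BiInterval.one _) (tupleMN m n (P.L b * Zl) (P.R d * Zr))

end BBProbSpace

/-- The index set `{(m, n) : m, n ≥ 0, m + n ≥ 1}`. -/
abbrev PairIndex : Type := {p : ℕ × ℕ // 1 ≤ p.1 + p.2}

/-- A Banach `B`-`B`-non-commutative probability space: `A` and `B` are Banach algebras and `E`,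
`b ↦ L_b` and `b ↦ R_b` are bounded. -/
structure BanachBBProbSpace (A B : Type*) [NormedRing A] [NormedAlgebra ℂ A] [CompleteSpace A]
    [NormedRing B] [NormedAlgebra ℂ B] [CompleteSpace B] extends BBProbSpace A B where
  E_bounded : ∃ C : ℝ, ∀ Z : A, ‖E Z‖ ≤ C * ‖Z‖
  left_bounded : ∃ C : ℝ, ∀ b : B, ‖toBBProbSpace.L b‖ ≤ C * ‖b‖
  right_bounded : ∃ C : ℝ, ∀ b : B, ‖toBBProbSpace.R b‖ ≤ C * ‖b‖

namespace BanachBBProbSpace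

variable {A B : Type*} [NormedRing A] [NormedAlgebra ℂ A] [CompleteSpace A]
  [NormedRing B] [NormedAlgebra ℂ B] [CompleteSpace B]

/-- `M_{Z_ℓ}^ℓ(b) = 1 + ∑_{m ≥ 1} E((L_b Z_ℓ)^m)` -/
noncomputable def MLeft (P : BanachBBProbSpace A B) (Zl : A) (b : B) : B :=
  1 + ∑' m : ℕ, P.momentLeft Zl b (m + 1)

/-- `M_{Z_r}^r(d) = 1 + ∑_{n ≥ 1} E((R_d Z_r)^n)` -/
noncomputable def MRight (P : BanachBBProbSpace A B) (Zr : A) (d : B) : B :=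
  1 + ∑' n : ℕ, P.momentRight Zr d (n + 1)

/-- `M_{(Z_ℓ, Z_r)}(b, d) = 1 + ∑_{m + n ≥ 1} E((L_b Z_ℓ)^m (R_d Z_r)^n)` -/
noncomputable def MPair (P : BanachBBProbSpace A B) (Zl Zr : A) (b d : B) : B :=
  1 + ∑' p : PairIndex, P.momentPair Zl Zr b d p.1.1 p.1.2

/-- `η_{Z_ℓ}^ℓ(b) = ∑_{m ≥ 1} B_{1_{χ_{m,0}}}(L_b Z_ℓ, …, L_b Z_ℓ)` -/
noncomputable def etaLeft (P : BanachBBProbSpace A B) (Zl : A) (b : B) : B :=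
  ∑' m : ℕ, P.cumulantLeft Zl b (m + 1)

/-- `η_{Z_r}^r(d) = ∑_{n ≥ 1} B_{1_{χ_{0,n}}}(R_d Z_r, …, R_d Z_r)` -/
noncomputable def etaRight (P : BanachBBProbSpace A B) (Zr : A) (d : B) : B :=
  ∑' n : ℕ, P.cumulantRight Zr d (n + 1)

/-- The operator-valued bi-Boolean partial η-transform
`η_{(Z_ℓ, Z_r)}(b, d) = ∑_{m + n ≥ 1} B_{1_{χ_{m,n}}}(L_b Z_ℓ, …, L_b Z_ℓ, R_d Z_r, …, R_d Z_r)` -/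
noncomputable def etaPair (P : BanachBBProbSpace A B) (Zl Zr : A) (b d : B) : B :=
  ∑' p : PairIndex, P.cumulantPair Zl Zr b d p.1.1 p.1.2

end BanachBBProbSpace

/-! List the points in `≺_χ`-order. A partition into intervals is the same as a set of cut positions
in `{1, …, N - 1}`, and refining means cutting more. So `BI(χ)` is a Boolean lattice upside down,
and `μ(σ, 1)` is `(-1)` to the number of cuts of `σ` (`muBI_one`). The moment function is a product
over the consecutive pieces, hence the full cumulant is a signed sum of such products over all cut
sets (`cumulant_one_eq_chainSum`).

Sorting this sum by the first cut gives a recursion. Let `g i j = E(x^i y^j)` with `x = L_b Z_ℓ`, `y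
= R_d Z_r`, and let `κ m n` be the cumulant, with `κ 0 0 = -1`. The first block is either `x^i` with
`i ≤ m`, leaving `κ (m - i) n`, or `x^m y^j` with `j ≥ 1`, leaving `κ 0 (n - j)`. Over all first
blocks, the empty one included, the terms add up to `0`, and to `-1` at `(0, 0)`
(`sum_mul_arrayCumulant`).

Since `κ 0 0 = -1`, summing `κ` gives `η - 1`. Cauchy products turn the recursion into `M^ℓ (η - 1)
+ (M - M^ℓ)(η^r - 1) = -1`, and on the two edges into `M^ℓ (η^ℓ - 1) = -1` and `M^r (η^r - 1) = -1`.
Solving for `η` is the theorem. Convergence is geometric: `‖g i j‖ ≤ K t^(i+j)` implies a bound of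
order `((1 + K) t)^(m+n)` for `κ`, and `t` is small when `b` and `d` are. -/

/-! ### Bi-interval partitions and their cut sets -/

section Cuts

variable {N : ℕ} {χ : Fin N → Side} {ρ : Equiv.Perm (Fin N)}

/-- `ρ` enumerates the indices in `≺_χ`-increasing order. -/
def IsChiEnum (χ : Fin N → Side) (ρ : Equiv.Perm (Fin N)) : Prop :=
  ∀ i j, chiLT χ (ρ i) (ρ j) ↔ i < j

/-- The indices `k` are in the same component of `ℕ` cut to the left of every element of `S`. -/
def cutSetoid (S : Finset ℕ) : Setoid ℕ where
  r i j := ∀ c ∈ S, c ≤ i ↔ c ≤ j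
  iseqv := ⟨fun _ _ _ => Iff.rfl, fun h c hc => (h c hc).symm,
    fun h h' c hc => (h c hc).trans (h' c hc)⟩

open Classical in
/-- The positions `c` at which the partition `σ` separates the `≺_χ`-neighbours `c - 1` and `c`. -/
noncomputable def cutSet (ρ : Equiv.Perm (Fin N)) (σ : BiInterval χ) : Finset ℕ :=
  (Finset.Ico 1 N).filter fun c =>
    ∀ i j : Fin N, (i : ℕ) + 1 = c → (j : ℕ) = c → ρ j ∉ σ.1.part (ρ i)

theorem mem_part_comm (σ : BiInterval χ) (i j : Fin N) :
    i ∈ σ.1.part j ↔ j ∈ σ.1.part i := by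
  rw [σ.1.mem_part_iff_part_eq_part (Finset.mem_univ _) (Finset.mem_univ _),
    σ.1.mem_part_iff_part_eq_part (Finset.mem_univ _) (Finset.mem_univ _), eq_comm]

theorem mem_part_trans (σ : BiInterval χ) {i j k : Fin N} (h : i ∈ σ.1.part j)
    (h' : j ∈ σ.1.part k) : i ∈ σ.1.part k := by
  rw [σ.1.mem_part_iff_part_eq_part (Finset.mem_univ _) (Finset.mem_univ _)] at *
  exact h.trans h'

theorem cutSet_subset (σ : BiInterval χ) : cutSet ρ σ ⊆ Finset.Ico 1 N :=
  Finset.filter_subset _ _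

theorem mem_part_of_between (hρ : IsChiEnum χ ρ) (σ : BiInterval χ) {i j k : Fin N}
    (hij : i ≤ j) (hjk : j ≤ k) (h : ρ k ∈ σ.1.part (ρ i)) : ρ j ∈ σ.1.part (ρ i) := by
  rcases hij.eq_or_lt with rfl | hij
  · exact σ.1.mem_part (Finset.mem_univ _)
  rcases hjk.eq_or_lt with rfl | hjk
  · exact h
  exact σ.2 _ (σ.1.part_mem.2 (Finset.mem_univ _)) _ (σ.1.mem_part (Finset.mem_univ _)) _ h _
    ((hρ _ _).2 hij) ((hρ _ _).2 hjk)

/-- A block is an interval, so if it contains both ends it contains `c - 1` and `c` for every `c`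
between, and no cut occurs there. Conversely, uncut neighbours share a block, and one walks from `i`
to `j`. -/
theorem mem_part_iff_of_le (hρ : IsChiEnum χ ρ) (σ : BiInterval χ) {i j : Fin N} (hij : i ≤ j) :
    ρ j ∈ σ.1.part (ρ i) ↔ ∀ c ∈ cutSet ρ σ, c ≤ (j : ℕ) → c ≤ i := by
  constructor
  · intro h c hc hcj
    by_contra! hci
    simp only [cutSet, Finset.mem_filter, Finset.mem_Ico] at hc
    obtain ⟨⟨h1, hN⟩, hc⟩ := hc
    refine hc ⟨c - 1, by omega⟩ ⟨c, hN⟩ (by simp; omega) rfl ?_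
    refine mem_part_trans σ (mem_part_of_between hρ σ hci.le hcj h) ((mem_part_comm σ _ _).1 ?_)
    exact mem_part_of_between hρ σ (Fin.le_def.2 (by simp; omega))
      (Fin.le_def.2 (by simp; omega)) h
  · obtain ⟨i, hi⟩ := i
    obtain ⟨j, hj⟩ := j
    simp only [Fin.mk_le_mk] at hij
    intro h
    induction j, hij using Nat.le_induction with
    | base => exact σ.1.mem_part (Finset.mem_univ _)
    | succ j hij ih =>
      have h1 := ih (by omega) fun c hc hcj => h c hc (by simp only at hcj ⊢; omega)
      have h2 : j + 1 ∉ cutSet ρ σ := fun hc => by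
        have := h _ hc le_rfl
        simp only at this
        omega
      simp only [cutSet, Finset.mem_filter, Finset.mem_Ico, not_and, not_forall, not_not] at h2
      obtain ⟨a, b, ha, hb, hab⟩ := h2 ⟨by omega, hj⟩
      have ha' : a = ⟨j, Nat.lt_of_succ_lt hj⟩ := Fin.ext (by simpa using ha)
      have hb' : b = ⟨j + 1, hj⟩ := Fin.ext hb
      subst ha' hb'
      exact mem_part_trans σ hab h1

theorem mem_part_iff_cutSet (hρ : IsChiEnum χ ρ) (σ : BiInterval χ) (i j : Fin N) :
    ρ j ∈ σ.1.part (ρ i) ↔ ∀ c ∈ cutSet ρ σ, c ≤ (i : ℕ) ↔ c ≤ (j : ℕ) := by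
  rcases le_total i j with h | h
  · rw [mem_part_iff_of_le hρ σ h]
    have h : (i : ℕ) ≤ j := h
    exact forall₂_congr fun c _ => ⟨fun h' => ⟨fun h'' => h''.trans h, h'⟩, fun h' => h'.2⟩
  · rw [mem_part_comm, mem_part_iff_of_le hρ σ h]
    have h : (j : ℕ) ≤ i := h
    exact forall₂_congr fun c _ => ⟨fun h' => ⟨h', fun h'' => h''.trans h⟩, fun h' => h'.1⟩

theorem biInterval_le_iff (σ τ : BiInterval χ) :
    σ ≤ τ ↔ ∀ i, σ.1.part i ⊆ τ.1.part i := by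
  constructor
  · intro h i
    obtain ⟨c, hc, hic⟩ := h (σ.1.part_mem.2 (Finset.mem_univ i))
    rwa [τ.1.part_eq_of_mem hc (hic (σ.1.mem_part (Finset.mem_univ i)))]
  · intro h b hb
    obtain ⟨i, hi⟩ := σ.1.nonempty_of_mem_parts hb
    refine ⟨τ.1.part i, τ.1.part_mem.2 (Finset.mem_univ i), ?_⟩
    rw [← σ.1.part_eq_of_mem hb hi]
    exact h i

theorem le_iff_cutSet_subset (hρ : IsChiEnum χ ρ) (σ τ : BiInterval χ) :
    σ ≤ τ ↔ cutSet ρ τ ⊆ cutSet ρ σ := by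
  rw [biInterval_le_iff]
  constructor
  · intro h c hc
    simp only [cutSet, Finset.mem_filter] at hc ⊢
    exact ⟨hc.1, fun i j hi hj hij => hc.2 i j hi hj (h _ hij)⟩
  · intro h i j
    obtain ⟨i, rfl⟩ := ρ.surjective i
    obtain ⟨j, rfl⟩ := ρ.surjective j
    rw [mem_part_iff_cutSet hρ, mem_part_iff_cutSet hρ]
    exact fun h' c hc => h' c (h hc)

theorem cutSet_injective (hρ : IsChiEnum χ ρ) :
    Function.Injective (cutSet ρ : BiInterval χ → Finset ℕ) := fun σ τ h =>
  le_antisymm ((le_iff_cutSet_subset hρ σ τ).2 h.ge) ((le_iff_cutSet_subset hρ τ σ).2 h.le)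

/-- Together with `le_iff_cutSet_subset` and `cutSet_injective`, this identifies `BI(χ)` with the
subsets of `Ico 1 N` under reverse inclusion. -/
theorem exists_cutSet_eq (hρ : IsChiEnum χ ρ) {S : Finset ℕ} (hS : S ⊆ Finset.Ico 1 N) :
    ∃ σ : BiInterval χ, cutSet ρ σ = S := by
  classical
  let s : Setoid (Fin N) := (cutSetoid S).comap fun i => ((ρ.symm i : Fin N) : ℕ)
  have hs (i j : Fin N) : ρ j ∈ (Finpartition.ofSetoid s).part (ρ i) ↔
      ∀ c ∈ S, c ≤ (i : ℕ) ↔ c ≤ (j : ℕ) := by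
    rw [Finpartition.mem_part_ofSetoid_iff_rel]
    change (∀ c ∈ S, c ≤ ((ρ.symm (ρ i) : Fin N) : ℕ) ↔ c ≤ ((ρ.symm (ρ j) : Fin N) : ℕ)) ↔ _
    simp
  have hint : ∀ V ∈ (Finpartition.ofSetoid s).parts, IsChiInterval χ V := by
    intro V hV i hi k hk j hij hjk
    obtain ⟨i, rfl⟩ := ρ.surjective i
    obtain ⟨j, rfl⟩ := ρ.surjective j
    obtain ⟨k, rfl⟩ := ρ.surjective k
    rw [← (Finpartition.ofSetoid s).part_eq_of_mem hV hi, hs] at hk ⊢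
    have hij : (i : ℕ) < j := (hρ _ _).1 hij
    have hjk : (j : ℕ) < k := (hρ _ _).1 hjk
    intro c hc
    have := hk c hc
    omega
  refine ⟨⟨Finpartition.ofSetoid s, hint⟩, ?_⟩
  ext c
  simp only [cutSet, Finset.mem_filter, hs]
  constructor
  · rintro ⟨h1, h2⟩
    rw [Finset.mem_Ico] at h1
    by_contra hc
    -- Only a cut at `c` itself separates `c - 1` from `c`.
    refine h2 ⟨c - 1, by omega⟩ ⟨c, h1.2⟩ (by simp; omega) rfl fun d hd => ?_
    have : d ≠ c := fun h => hc (h ▸ hd)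
    simp only
    omega
  · intro hc
    refine ⟨hS hc, fun i j hi hj h => ?_⟩
    have := h c hc
    omega

theorem cutSet_one (hρ : IsChiEnum χ ρ) : cutSet ρ (BiInterval.one χ) = ∅ := by
  rw [← Finset.subset_empty]
  obtain ⟨σ, hσ⟩ := exists_cutSet_eq hρ (Finset.empty_subset (Finset.Ico 1 N))
  rw [← hσ, ← le_iff_cutSet_subset hρ]
  exact (le_top : σ.1 ≤ ⊤)

theorem le_biInterval_one (σ : BiInterval χ) : σ ≤ BiInterval.one χ :=
  (le_top : σ.1 ≤ ⊤)

/-- Summation over bi-interval partitions above `σ` is summation over subsets of its cut set. -/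
theorem sum_above_eq_sum_powerset {M : Type*} [AddCommMonoid M] (hρ : IsChiEnum χ ρ)
    (σ : BiInterval χ) (s : Finset (BiInterval χ)) (hs : ∀ τ, τ ∈ s ↔ σ ≤ τ)
    (f : Finset ℕ → M) :
    ∑ τ ∈ s, f (cutSet ρ τ) = ∑ S ∈ (cutSet ρ σ).powerset, f S := by
  refine Finset.sum_bij (fun τ _ => cutSet ρ τ) ?_ (fun _ _ _ _ h => cutSet_injective hρ h) ?_
    fun _ _ => rfl
  · intro τ hτ
    exact Finset.mem_powerset.2 ((le_iff_cutSet_subset hρ _ _).1 ((hs τ).1 hτ))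
  · intro S hS
    rw [Finset.mem_powerset] at hS
    obtain ⟨τ, rfl⟩ := exists_cutSet_eq hρ (hS.trans (cutSet_subset σ))
    exact ⟨τ, (hs τ).2 ((le_iff_cutSet_subset hρ _ _).2 hS), rfl⟩

/-- The interval `[σ, 1]` corresponds to the power set of the cuts of `σ`, over which the
alternating sum vanishes unless there are no cuts. So the sign satisfies the recursion that defines
the Möbius function; the induction is on the number of cuts. -/
theorem muBI_one (hρ : IsChiEnum χ ρ) (σ : BiInterval χ) :
    muBI χ σ (BiInterval.one χ) = (-1) ^ (cutSet ρ σ).card := by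
  classical
  induction hn : (cutSet ρ σ).card using Nat.strong_induction_on generalizing σ with
  | _ n ih =>
  subst hn
  unfold muBI at ih ⊢
  have hle := le_biInterval_one σ
  by_cases h : σ = BiInterval.one χ
  · subst h
    simp [cutSet_one hρ]
  rw [IncidenceAlgebra.mu_eq_neg_sum_Ioc_of_ne h]
  have key : ∑ τ ∈ Finset.Icc σ (BiInterval.one χ), (-1 : ℂ) ^ (cutSet ρ τ).card = 0 := by
    rw [sum_above_eq_sum_powerset hρ σ _ (fun τ => by simp [le_biInterval_one])
      (fun S => (-1 : ℂ) ^ S.card)]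
    have h0 : cutSet ρ σ ≠ ∅ := fun h0 => h (cutSet_injective hρ (h0.trans (cutSet_one hρ).symm))
    have := Finset.sum_powerset_neg_one_pow_card (x := cutSet ρ σ)
    rw [if_neg h0] at this
    exact_mod_cast congrArg (Int.cast : ℤ → ℂ) this
  rw [← Finset.sum_Ioc_add_eq_sum_Icc hle] at key
  rw [eq_neg_of_add_eq_zero_right key]
  refine congrArg Neg.neg (Finset.sum_congr rfl fun τ hτ => ?_)
  rw [Finset.mem_Ioc] at hτ
  refine ih _ ?_ τ rfl
  exact Finset.card_lt_card ((Finset.ssubset_iff_subset_ne).2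
    ⟨(le_iff_cutSet_subset hρ _ _).1 hτ.1.le, fun h => hτ.1.ne (cutSet_injective hρ h.symm)⟩)

/-- Summation over all bi-interval partitions is summation over all sets of cut positions. -/
theorem sum_eq_sum_powerset {M : Type*} [AddCommMonoid M] (hρ : IsChiEnum χ ρ)
    (s : Finset (BiInterval χ)) (hs : ∀ τ, τ ∈ s) (f : Finset ℕ → M) :
    ∑ τ ∈ s, f (cutSet ρ τ) = ∑ S ∈ (Finset.Ico 1 N).powerset, f S := by
  obtain ⟨ζ, hζ⟩ := exists_cutSet_eq hρ (Finset.Subset.refl (Finset.Ico 1 N))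
  rw [← hζ, ← sum_above_eq_sum_powerset hρ ζ s]
  intro τ
  simp only [hs, true_iff]
  rw [le_iff_cutSet_subset hρ, hζ]
  exact cutSet_subset τ

theorem cumulant_one_eq_sum {A B : Type*} [Ring A] [Algebra ℂ A] [Ring B] [Algebra ℂ B]
    (P : BBProbSpace A B) (hρ : IsChiEnum χ ρ) (Z : Fin N → A) (F : Finset ℕ → B)
    (hF : ∀ σ : BiInterval χ, P.momentFn χ σ Z = F (cutSet ρ σ)) :
    P.cumulant χ (BiInterval.one χ) Z =
      ∑ S ∈ (Finset.Ico 1 N).powerset, (-1 : B) ^ S.card * F S := by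
  classical
  have hterm (σ : BiInterval χ) : muBI χ σ (BiInterval.one χ) • P.momentFn χ σ Z =
      (-1 : B) ^ (cutSet ρ σ).card * F (cutSet ρ σ) := by
    rw [muBI_one hρ, hF]
    rcases Nat.even_or_odd (cutSet ρ σ).card with h | h <;>
      rw [h.neg_one_pow, h.neg_one_pow] <;> simp
  unfold BBProbSpace.cumulant
  simp only [hterm]
  rw [sum_eq_sum_powerset hρ _ _ (fun S => (-1 : B) ^ S.card * F S)]
  intro τ
  rw [Finset.mem_filter]
  exact ⟨Finset.mem_univ τ, le_biInterval_one τ⟩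

end Cuts

/-! ### Products along a chain of cuts -/

section Chains

variable {B : Type*} [Ring B]

/-- The product of the `f p q` over the consecutive pieces `[p, q)` into which the elements of `S`
in `[k, k + r)` cut `[p, k + r)`. -/
noncomputable def chainProd (f : ℕ → ℕ → B) (S : Finset ℕ) : ℕ → ℕ → ℕ → B
  | p, k, 0 => f p k
  | p, k, r + 1 =>
    if k ∈ S then f p k * chainProd f S k (k + 1) r else chainProd f S p (k + 1) r

/-- The signed sum of the chain products over all sets of cuts in `[k, k + r)`. -/
def chainSum (f : ℕ → ℕ → B) : ℕ → ℕ → ℕ → B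
  | p, k, 0 => f p k
  | p, k, r + 1 => chainSum f p (k + 1) r - f p k * chainSum f k (k + 1) r

theorem chainProd_congr (f : ℕ → ℕ → B) {S T : Finset ℕ} (r : ℕ) :
    ∀ p k, (∀ c, k ≤ c → (c ∈ S ↔ c ∈ T)) → chainProd f S p k r = chainProd f T p k r := by
  induction r with
  | zero => intros; rfl
  | succ r ih =>
    intro p k h
    have h' : ∀ c, k + 1 ≤ c → (c ∈ S ↔ c ∈ T) := fun c hc => h c (by omega)
    simp only [chainProd, h k le_rfl, ih _ _ h']

/-- Sort the cut sets by whether they contain `k`. If so, the piece `[p, k)` splits off as a left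
factor and the cut contributes a sign. -/
theorem sum_powerset_chainProd (f : ℕ → ℕ → B) (r : ℕ) : ∀ p k,
    ∑ S ∈ (Finset.Ico k (k + r)).powerset, (-1 : B) ^ S.card * chainProd f S p k r =
      chainSum f p k r := by
  induction r with
  | zero => intro p k; simp [chainProd, chainSum]
  | succ r ih =>
    intro p k
    have hk : k ∉ Finset.Ico (k + 1) (k + 1 + r) := by simp
    have hI : Finset.Ico k (k + (r + 1)) = insert k (Finset.Ico (k + 1) (k + 1 + r)) := by
      ext; simp; omega
    rw [hI, Finset.sum_powerset_insert hk, chainSum, ← ih, ← ih, sub_eq_add_neg, Finset.mul_sum,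
      ← Finset.sum_neg_distrib]
    congr 1 <;> refine Finset.sum_congr rfl fun S hS => ?_
    all_goals
      rw [Finset.mem_powerset] at hS
      have hkS : k ∉ S := fun h => hk (hS h)
    · rw [chainProd, if_neg hkS]
    · rw [chainProd, if_pos (Finset.mem_insert_self _ _), Finset.card_insert_of_notMem hkS,
        chainProd_congr f (T := S) r k (k + 1)]
      · rcases Nat.even_or_odd S.card with h | h <;> simp [pow_succ, h.neg_one_pow]
      · intro c hc
        simp only [Finset.mem_insert, or_iff_right_iff_imp]
        omega

/-- Sorting by the first cut `k + i`: the leading term has no cut at all, and each other term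
carries the sign of its first cut. -/
theorem chainSum_eq_sub_sum (f : ℕ → ℕ → B) (r : ℕ) : ∀ p k,
    chainSum f p k r = f p (k + r) -
      ∑ i ∈ Finset.range r, f p (k + i) * chainSum f (k + i) (k + i + 1) (r - 1 - i) := by
  induction r with
  | zero => intro p k; simp [chainSum]
  | succ r ih =>
    intro p k
    rw [chainSum, ih, Finset.sum_range_succ', sub_add_eq_sub_sub]
    simp only [add_zero, Nat.add_sub_cancel, Nat.sub_zero]
    congr 2
    · congr 1
      omega
    · refine Finset.sum_congr rfl fun i _ => ?_
      rw [show k + (i + 1) = k + 1 + i by omega, show r - (i + 1) = r - 1 - i by omega]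

theorem chainSum_shift (f g : ℕ → ℕ → B) (s : ℕ) (h : ∀ p q, p ≤ q → f (p + s) (q + s) = g p q)
    (r : ℕ) : ∀ p k, p ≤ k → chainSum f (p + s) (k + s) r = chainSum g p k r := by
  induction r with
  | zero => intro p k hpk; exact h p k hpk
  | succ r ih =>
    intro p k hpk
    have h1 := ih p (k + 1) (by omega)
    have h2 := ih k (k + 1) (by omega)
    rw [show k + 1 + s = k + s + 1 by omega] at h1 h2
    rw [chainSum, chainSum, h1, h2, h p k hpk]

/-- Here `F p` stands for the moment of the block that starts at `p`. The scan keeps `p` as the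
start of the current block while `k` runs to the next cut or to `N`. -/
theorem prod_filter_eq_chainProd {N : ℕ} {S : Finset ℕ} {f : ℕ → ℕ → B} {F : ℕ → B}
    (hF : ∀ p q, p < q → q ≤ N → (q < N → q ∈ S) → (p = 0 ∨ p ∈ S) →
      (∀ c ∈ S, p < c → q ≤ c) → F p = f p q) (r : ℕ) :
    ∀ p k, k + r = N → p < k → (p = 0 ∨ p ∈ S) → (∀ c ∈ S, p < c → k ≤ c) →
      F p * (((List.range' k r).filter (· ∈ S)).map F).prod = chainProd f S p k r := by
  induction r with
  | zero =>
    intro p k hk hpk hp hc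
    simpa [chainProd] using hF p k hpk (by omega) (by omega) hp hc
  | succ r ih =>
    intro p k hk hpk hp hc
    rw [List.range'_succ, chainProd]
    split_ifs with hkS
    · rw [List.filter_cons_of_pos (by simpa using hkS), List.map_cons, List.prod_cons,
        ih k (k + 1) (by omega) (by omega) (Or.inr hkS) (fun c _ h => h),
        hF p k hpk (by omega) (fun _ => hkS) hp hc]
    · rw [List.filter_cons_of_neg (by simpa using hkS)]
      refine ih p (k + 1) (by omega) (by omega) hp fun c hcS h => ?_
      have : c ≠ k := fun h => hkS (h ▸ hcS)
      have := hc c hcS h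
      omega

end Chains

/-! ### The moment function through cuts -/

section MomentFn

variable {N : ℕ} {χ : Fin N → Side} {ρ : Equiv.Perm (Fin N)}

/-- A position other than `0` that is not a cut lies in the block of its predecessor, so it is not
the minimum. -/
theorem isChiMin_part_iff (hρ : IsChiEnum χ ρ) (σ : BiInterval χ) (k : Fin N) :
    IsChiMin χ (σ.1.part (ρ k)) (ρ k) ↔ (k : ℕ) = 0 ∨ (k : ℕ) ∈ cutSet ρ σ := by
  constructor
  · rintro ⟨-, h⟩
    by_contra! hk
    have hlt : (k : ℕ) - 1 < N := by omega
    have hmem : ρ ⟨k - 1, hlt⟩ ∈ σ.1.part (ρ k) := by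
      rw [mem_part_iff_cutSet hρ]
      intro c hc
      have : c ≠ k := fun h => hk.2 (h ▸ hc)
      simp only
      omega
    rcases h _ hmem with h | h
    · have := congrArg Fin.val (ρ.injective h)
      simp only at this
      omega
    · have : (k : ℕ) < k - 1 := (hρ _ _).1 h
      omega
  · intro h
    refine ⟨σ.1.mem_part (Finset.mem_univ _), fun j hj => ?_⟩
    obtain ⟨j, rfl⟩ := ρ.surjective j
    rw [mem_part_iff_cutSet hρ] at hj
    rw [hρ, ρ.injective.eq_iff, Fin.lt_def, Fin.ext_iff]
    rcases h with h | h
    · omega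
    · have := hj _ h
      omega

theorem momentFn_eq_chainProd {A B : Type*} [Ring A] [Algebra ℂ A] [Ring B] [Algebra ℂ B]
    (P : BBProbSpace A B) (hρ : IsChiEnum χ ρ) (hlist : chiList χ = (List.finRange N).map ρ)
    (hN : 1 ≤ N) (Z : Fin N → A) (f : ℕ → ℕ → B)
    (hf : ∀ p q, p < q → q ≤ N → ∀ V : Finset (Fin N),
      (∀ j, ρ j ∈ V ↔ p ≤ (j : ℕ) ∧ (j : ℕ) < q) → P.blockMoment Z V = f p q)
    (σ : BiInterval χ) :
    P.momentFn χ σ Z = chainProd f (cutSet ρ σ) 0 1 (N - 1) := by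
  set S := cutSet ρ σ
  -- The value `1` beyond `N` is a dummy; only positions below `N` occur.
  let F : ℕ → B := fun k => if h : k < N then P.blockMoment Z (σ.1.part (ρ ⟨k, h⟩)) else 1
  have hF : ∀ p q, p < q → q ≤ N → (q < N → q ∈ S) → (p = 0 ∨ p ∈ S) →
      (∀ c ∈ S, p < c → q ≤ c) → F p = f p q := by
    intro p q hpq hq hqS hp hc
    have hpN : p < N := by omega
    simp only [F, dif_pos hpN]
    refine hf p q hpq hq _ fun j => ?_
    rw [mem_part_iff_cutSet hρ]
    simp only
    constructor
    · intro h
      constructor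
      · rcases hp with hp | hp
        · omega
        · exact (h p hp).1 le_rfl
      · by_cases hqN : q < N
        · have := h q (hqS hqN)
          omega
        · omega
    · intro h c hcS
      have := hc c hcS
      omega
  rw [← prod_filter_eq_chainProd hF (N - 1) 0 1 (by omega) one_pos (Or.inl rfl)
    fun c _ h => h]
  have hrange : (List.range N) = 0 :: List.range' 1 (N - 1) := by
    rw [List.range_eq_range']
    conv_lhs => rw [show N = (N - 1) + 1 by omega, List.range'_succ]
  have h0 : F 0 * (((List.range' 1 (N - 1)).filter (· ∈ S)).map F).prod =
      (((List.range N).filter fun k => k = 0 ∨ k ∈ S).map F).prod := by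
    rw [hrange, List.filter_cons_of_pos (by simp), List.map_cons, List.prod_cons]
    congr 3
    refine List.filter_congr fun k hk => ?_
    have : k ≠ 0 := by
      have := List.mem_range'_1.1 hk
      omega
    simp [this]
  rw [h0, ← List.map_coe_finRange_eq_range, BBProbSpace.momentFn, hlist, List.filter_map,
    List.filter_map, List.map_map, List.map_map]
  congr 1
  have hfil : (List.finRange N).filter
      ((fun i => decide (IsChiMin χ (σ.1.part i) i)) ∘ ρ) =
      (List.finRange N).filter ((fun k : ℕ => decide (k = 0 ∨ k ∈ S)) ∘ fun i : Fin N => (i : ℕ)) :=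
    List.filter_congr fun k _ => decide_eq_decide.2 (isChiMin_part_iff hρ σ k)
  rw [hfil]
  refine List.map_congr_left fun k _ => ?_
  simp [F]

theorem cumulant_one_eq_chainSum {A B : Type*} [Ring A] [Algebra ℂ A] [Ring B] [Algebra ℂ B]
    (P : BBProbSpace A B) (hρ : IsChiEnum χ ρ) (hlist : chiList χ = (List.finRange N).map ρ)
    (hN : 1 ≤ N) (Z : Fin N → A) (f : ℕ → ℕ → B)
    (hf : ∀ p q, p < q → q ≤ N → ∀ V : Finset (Fin N),
      (∀ j, ρ j ∈ V ↔ p ≤ (j : ℕ) ∧ (j : ℕ) < q) → P.blockMoment Z V = f p q) :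
    P.cumulant χ (BiInterval.one χ) Z = chainSum f 0 1 (N - 1) := by
  rw [cumulant_one_eq_sum P hρ Z (fun S => chainProd f S 0 1 (N - 1))
    (momentFn_eq_chainProd P hρ hlist hN Z f hf), ← sum_powerset_chainProd,
    Nat.add_sub_cancel' hN]

end MomentFn

/-! ### The enumeration of `≺_χ` and the block moments for `χ_{m,n}` -/

section ChiMN

variable (m n : ℕ)

/-- The `≺_χ`-increasing enumeration for `χ = χ_{m,n}`. -/
def chiMNEnum : Equiv.Perm (Fin (m + n)) :=
  Function.Involutive.toPerm
    -- Reflection of `{m, …, m + n - 1}`, which reverses the right indices and is its own inverse.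
    (fun k => if h : (k : ℕ) < m then k else ⟨2 * m + n - 1 - k, by omega⟩) (by
      intro k
      apply Fin.ext
      by_cases h : (k : ℕ) < m
      · simp [h]
      · have : ¬ (2 * m + n - 1 - k < m) := by omega
        simp only [h, this, dite_false]
        omega)

theorem chiMNEnum_val (k : Fin (m + n)) :
    (chiMNEnum m n k : ℕ) = if (k : ℕ) < m then (k : ℕ) else 2 * m + n - 1 - k := by
  change ((if h : (k : ℕ) < m then k else ⟨2 * m + n - 1 - k, by omega⟩ : Fin (m + n)) : ℕ) = _
  split_ifs <;> rfl

theorem chiMNEnum_chiMNEnum (k : Fin (m + n)) : chiMNEnum m n (chiMNEnum m n k) = k :=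
  (chiMNEnum m n).left_inv k

theorem isChiEnum_chiMNEnum : IsChiEnum (chiMN m n) (chiMNEnum m n) := by
  intro i j
  have hi := chiMNEnum_val m n i
  have hj := chiMNEnum_val m n j
  unfold chiLT
  by_cases h1 : (i : ℕ) < m <;> by_cases h2 : (j : ℕ) < m
  · have e1 : chiMN m n (chiMNEnum m n i) = Side.left := if_pos (by simp [hi, h1])
    have e2 : chiMN m n (chiMNEnum m n j) = Side.left := if_pos (by simp [hj, h2])
    simp only [e1, e2]
    rw [Fin.lt_def, Fin.lt_def, hi, hj, if_pos h1, if_pos h2]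
  · have e1 : chiMN m n (chiMNEnum m n i) = Side.left := if_pos (by simp [hi, h1])
    have e2 : chiMN m n (chiMNEnum m n j) = Side.right :=
      if_neg (by rw [hj, if_neg h2]; omega)
    simp only [e1, e2, Fin.lt_def, true_iff]
    omega
  · have e1 : chiMN m n (chiMNEnum m n i) = Side.right :=
      if_neg (by rw [hi, if_neg h1]; omega)
    have e2 : chiMN m n (chiMNEnum m n j) = Side.left := if_pos (by simp [hj, h2])
    simp only [e1, e2, Fin.lt_def, false_iff]
    omega
  · have e1 : chiMN m n (chiMNEnum m n i) = Side.right :=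
      if_neg (by rw [hi, if_neg h1]; omega)
    have e2 : chiMN m n (chiMNEnum m n j) = Side.right :=
      if_neg (by rw [hj, if_neg h2]; omega)
    simp only [e1, e2, Fin.lt_def, hi, hj, if_neg h1, if_neg h2]
    omega

theorem map_val_filter_finRange {N : ℕ} (p : ℕ → Bool) :
    ((List.finRange N).filter fun k : Fin N => p k).map (fun k : Fin N => (k : ℕ)) = (List.range N).filter p := by
  rw [← List.map_coe_finRange_eq_range, List.filter_map]
  rfl

theorem chiList_chiMN : chiList (chiMN m n) = (List.finRange (m + n)).map (chiMNEnum m n) := by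
  apply List.map_injective_iff.2 Fin.val_injective
  have hl : ((List.finRange (m + n)).filter fun i => decide (chiMN m n i = Side.left)).map
      (fun k : Fin (m + n) => (k : ℕ)) = List.range m := by
    have : (fun i : Fin (m + n) => decide (chiMN m n i = Side.left)) =
        fun i : Fin (m + n) => (fun k : ℕ => decide (k < m)) i := by
      funext i
      simp only [chiMN]
      split_ifs with h <;> simp [h]
    rw [this, map_val_filter_finRange (fun k => decide (k < m)), List.range_add,
      List.filter_append, List.filter_eq_self.2 (by simp), List.filter_eq_nil_iff.2 (by simp), List.append_nil]
  have hr : ((List.finRange (m + n)).filter fun i => decide (chiMN m n i = Side.right)).map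
      (fun k : Fin (m + n) => (k : ℕ)) = (List.range n).map (m + ·) := by
    have : (fun i : Fin (m + n) => decide (chiMN m n i = Side.right)) =
        fun i : Fin (m + n) => (fun k : ℕ => decide (m ≤ k)) i := by
      funext i
      simp only [chiMN]
      split_ifs with h <;> simp [h]; omega
    rw [this, map_val_filter_finRange (fun k => decide (m ≤ k)), List.range_add,
      List.filter_append, List.filter_eq_nil_iff.2 (by simp), List.filter_eq_self.2 (by simp), List.nil_append]
  change (chiList (chiMN m n)).map (fun k : Fin (m + n) => (k : ℕ)) =
    ((List.finRange (m + n)).map (chiMNEnum m n)).map (fun k : Fin (m + n) => (k : ℕ))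
  rw [chiList, List.map_append, List.map_reverse, hl, hr, List.map_map]
  have : ((fun k : Fin (m + n) => (k : ℕ)) ∘ chiMNEnum m n) =
      (fun k : ℕ => if k < m then k else 2 * m + n - 1 - k) ∘ fun k : Fin (m + n) => (k : ℕ) := by
    funext k
    exact chiMNEnum_val m n k
  rw [this, ← List.map_map, List.map_coe_finRange_eq_range, List.range_add, List.map_append]
  congr 1
  · symm
    refine (List.map_congr_left fun k hk => ?_).trans (List.map_id _)
    simp only [List.mem_range] at hk
    simp [hk]
  · apply List.ext_getElem (by simp)
    intro i h1 h2
    simp only [List.length_reverse, List.length_map, List.length_range] at h1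
    simp only [List.getElem_reverse, List.getElem_map, List.getElem_range, List.length_map,
      List.length_range]
    rw [if_neg (by omega)]
    omega

theorem length_filter_range (N : ℕ) (p : ℕ → Prop) [DecidablePred p] :
    ((List.range N).filter p).length = ((Finset.range N).filter p).card := rfl

/-- The product over a block of `tupleMN m n x y` is `x` to the number of left indices times `y`
to the number of right indices. -/
theorem prod_map_tupleMN {A : Type*} [Monoid A] (x y : A) (p : ℕ → Prop) [DecidablePred p]
    (V : Finset (Fin (m + n))) (hV : ∀ k : Fin (m + n), k ∈ V ↔ p k) :
    (((List.finRange (m + n)).filter (fun j => j ∈ V)).map (tupleMN m n x y)).prod =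
      x ^ ((Finset.range m).filter p).card *
        y ^ ((Finset.range n).filter fun k => p (m + k)).card := by
  have h1 : (tupleMN m n x y) = (fun k : ℕ => if k < m then x else y) ∘
      fun k : Fin (m + n) => (k : ℕ) := rfl
  have h2 : (fun j : Fin (m + n) => decide (j ∈ V)) =
      fun j : Fin (m + n) => (fun k : ℕ => decide (p k)) j := by
    funext j
    exact decide_eq_decide.2 (hV j)
  rw [h1, ← List.map_map, h2, map_val_filter_finRange (fun k => decide (p k)),
    List.range_add, List.filter_append, List.map_append, List.prod_append, List.filter_map, List.map_map]
  congr 1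
  · rw [← length_filter_range]
    refine (List.prod_eq_pow_card _ x fun z hz => ?_).trans (by rw [List.length_map])
    simp only [List.mem_map, List.mem_filter, List.mem_range] at hz
    obtain ⟨k, ⟨hk, -⟩, rfl⟩ := hz
    rw [if_pos hk]
  · rw [← length_filter_range]
    refine (List.prod_eq_pow_card _ y fun z hz => ?_).trans (by rw [List.length_map]; rfl)
    simp only [List.mem_map, List.mem_filter, List.mem_range] at hz
    obtain ⟨k, -, rfl⟩ := hz
    simp

/-- The moment of the positions `[p, q)` in the order `≺_χ`, where `χ = χ_{m,n}` and
`g i j = E(x^i y^j)`. -/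
def intervalMoment {B : Type*} (g : ℕ → ℕ → B) (m p q : ℕ) : B :=
  g (min q m - min p m) (max q m - max p m)

/-- Dropping the first `s` positions leaves `m - s` left ones; truncated subtraction covers `s > m`,
where only right ones remain. -/
theorem intervalMoment_shift {B : Type*} (g : ℕ → ℕ → B) (m s p q : ℕ) (hpq : p ≤ q) :
    intervalMoment g m (p + s) (q + s) = intervalMoment g (m - s) p q := by
  unfold intervalMoment
  congr 1 <;> omega

theorem blockMoment_tupleMN {A B : Type*} [Ring A] [Algebra ℂ A] [Ring B] [Algebra ℂ B]
    (P : BBProbSpace A B) (x y : A) (p q : ℕ) (hpq : p < q) (hq : q ≤ m + n)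
    (V : Finset (Fin (m + n)))
    (hV : ∀ j, chiMNEnum m n j ∈ V ↔ p ≤ (j : ℕ) ∧ (j : ℕ) < q) :
    P.blockMoment (tupleMN m n x y) V =
      intervalMoment (fun i j => P.E (x ^ i * y ^ j)) m p q := by
  have hV' (k : Fin (m + n)) : k ∈ V ↔
      p ≤ (if (k : ℕ) < m then (k : ℕ) else 2 * m + n - 1 - k) ∧
        (if (k : ℕ) < m then (k : ℕ) else 2 * m + n - 1 - k) < q := by
    rw [← chiMNEnum_val, ← hV, chiMNEnum_chiMNEnum]
  rw [BBProbSpace.blockMoment, intervalMoment, prod_map_tupleMN m n x y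
    (fun k => p ≤ (if k < m then k else 2 * m + n - 1 - k) ∧
      (if k < m then k else 2 * m + n - 1 - k) < q) V hV']
  congr 3
  · rw [← Nat.card_Ico (min p m) (min q m)]
    refine congrArg Finset.card (Finset.ext fun k => ?_)
    simp only [Finset.mem_filter, Finset.mem_range, Finset.mem_Ico]
    by_cases hk : k < m
    · rw [if_pos hk]
      omega
    · rw [if_neg hk]
      omega
  -- The right index `m + k` sits at position `m + n - 1 - k`, so the interval of positions is
  -- reflected.
  · rw [show max q m - max p m = (m + n - max p m) - (m + n - max q m) by omega,
      ← Nat.card_Ico (m + n - max q m) (m + n - max p m)]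
    refine congrArg Finset.card (Finset.ext fun k => ?_)
    simp only [Finset.mem_filter, Finset.mem_range, Finset.mem_Ico]
    rw [if_neg (by omega)]
    omega

end ChiMN

/-! ### One-sided and two-sided cumulants as entries of one array -/

section Cumulants

variable {A B : Type*} [Ring A] [Algebra ℂ A] [Ring B] [Algebra ℂ B]

namespace BBProbSpace

theorem cumulantPair_eq_chainSum (P : BBProbSpace A B) (Zl Zr : A) (b d : B) (m n : ℕ)
    (hmn : 1 ≤ m + n) :
    P.cumulantPair Zl Zr b d m n =
      chainSum (intervalMoment (P.momentPair Zl Zr b d) m) 0 1 (m + n - 1) :=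
  cumulant_one_eq_chainSum P (isChiEnum_chiMNEnum m n) (chiList_chiMN m n) hmn _ _
    fun p q hpq hq V hV => blockMoment_tupleMN m n P _ _ p q hpq hq V hV

theorem cumulantLeft_eq_cumulantPair (P : BBProbSpace A B) (Zl Zr : A) (b d : B) (m : ℕ) :
    P.cumulantLeft Zl b m = P.cumulantPair Zl Zr b d m 0 := by
  unfold cumulantLeft cumulantPair
  congr 1
  funext k
  exact (if_pos k.2).symm

theorem cumulantRight_eq_cumulantPair (P : BBProbSpace A B) (Zl Zr : A) (b d : B) (n : ℕ) :
    P.cumulantRight Zr d n = P.cumulantPair Zl Zr b d 0 n := by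
  unfold cumulantRight cumulantPair
  congr 1

theorem momentLeft_eq_momentPair (P : BBProbSpace A B) (Zl Zr : A) (b d : B) (m : ℕ) :
    P.momentLeft Zl b m = P.momentPair Zl Zr b d m 0 := by
  simp [momentLeft, momentPair]

theorem momentRight_eq_momentPair (P : BBProbSpace A B) (Zl Zr : A) (b d : B) (n : ℕ) :
    P.momentRight Zr d n = P.momentPair Zl Zr b d 0 n := by
  simp [momentRight, momentPair]

end BBProbSpace

end Cumulants

/-! ### Cumulants of a double array of moments -/

section Arrays

variable {B : Type*} [Ring B]

/-- The bi-Boolean cumulants of the array of moments `g i j = E(x^i y^j)`, with the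
convention `-1` for the index `(0, 0)`. -/
def arrayCumulant (g : ℕ → ℕ → B) (m n : ℕ) : B :=
  if m + n = 0 then -1 else chainSum (intervalMoment g m) 0 1 (m + n - 1)

/-- The moment-cumulant recursion, splitting off the first block. -/
theorem sum_mul_arrayCumulant (g : ℕ → ℕ → B) (h0 : g 0 0 = 1) (m n : ℕ) :
    ∑ i ∈ Finset.range (m + 1), g i 0 * arrayCumulant g (m - i) n +
      ∑ j ∈ Finset.range n, g m (j + 1) * arrayCumulant g 0 (n - (j + 1)) =
      if m + n = 0 then -1 else 0 := by
  -- What remains after a first block `[0, i)` is again a cumulant of the same array.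
  have hterm (i : ℕ) (hi : i < m + n) : chainSum (intervalMoment g m) i (i + 1) (m + n - 1 - i) =
      arrayCumulant g (m - i) (n - (i - m)) := by
    rw [arrayCumulant, if_neg (by omega), show m - i + (n - (i - m)) - 1 = m + n - 1 - i by omega]
    have := chainSum_shift (intervalMoment g m) (intervalMoment g (m - i)) i
      (fun p q h => intervalMoment_shift g m i p q h) (m + n - 1 - i) 0 1 zero_le_one
    rwa [zero_add, add_comm 1 i] at this
  split_ifs with hmn
  · obtain ⟨rfl, rfl⟩ : m = 0 ∧ n = 0 := by omega
    simp [arrayCumulant, h0]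
  -- the sum over the end point `i` of the first block, `0 ≤ i ≤ m + n`
  have hall : ∑ i ∈ Finset.range (m + 1 + n),
      intervalMoment g m 0 i * arrayCumulant g (m - i) (n - (i - m)) = 0 := by
    obtain ⟨N, hN⟩ : ∃ N, m + n = N + 1 := ⟨m + n - 1, by omega⟩
    -- Split off the full block, whose remainder is `κ 0 0 = -1`, and the empty block, whose
    -- remainder is the whole cumulant.
    rw [show m + 1 + n = N + 1 + 1 by omega, Finset.sum_range_succ, Finset.sum_range_succ']
    have e0 : intervalMoment g m 0 0 = 1 := by simp [intervalMoment, h0]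
    have e1 : arrayCumulant g (m - 0) (n - (0 - m)) =
        chainSum (intervalMoment g m) 0 1 N := by
      rw [← hterm 0 (by omega), show m + n - 1 - 0 = N by omega]
    have e2 : arrayCumulant g (m - (N + 1)) (n - (N + 1 - m)) = -1 := if_pos (by omega)
    rw [e0, e1, e2, chainSum_eq_sub_sum]
    have e3 : ∑ k ∈ Finset.range N, intervalMoment g m 0 (k + 1) *
        arrayCumulant g (m - (k + 1)) (n - (k + 1 - m)) =
        ∑ i ∈ Finset.range N, intervalMoment g m 0 (1 + i) *
          chainSum (intervalMoment g m) (1 + i) (1 + i + 1) (N - 1 - i) := by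
      refine Finset.sum_congr rfl fun i hi => ?_
      rw [Finset.mem_range] at hi
      rw [← hterm (i + 1) (by omega), add_comm 1 i,
        show m + n - 1 - (i + 1) = N - 1 - i by omega]
    rw [e3, add_comm 1 N]
    simp
  rw [Finset.sum_range_add] at hall
  rw [← hall]
  congr 1 <;> refine Finset.sum_congr rfl fun i hi => ?_
  all_goals rw [Finset.mem_range] at hi
  · rw [show n - (i - m) = n by omega, intervalMoment]
    congr 2 <;> omega
  · rw [intervalMoment]
    congr 2 <;> omega

end Arrays

/-! ### Summation of the recursion -/

section SummableArrays

variable {B : Type*} [NormedRing B]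

theorem summable_norm_left {f : ℕ → ℕ → B}
    (hf : Summable fun p : ℕ × ℕ => ‖f p.1 p.2‖) (n : ℕ) : Summable fun m => ‖f m n‖ :=
  hf.prod_symm.prod_factor n

theorem summable_norm_right {f : ℕ → ℕ → B}
    (hf : Summable fun p : ℕ × ℕ => ‖f p.1 p.2‖) (m : ℕ) : Summable fun n => ‖f m n‖ :=
  hf.prod_factor m

theorem summable_norm_tsum_left {f : ℕ → ℕ → B}
    (hf : Summable fun p : ℕ × ℕ => ‖f p.1 p.2‖) : Summable fun n => ‖∑' m, f m n‖ :=
  Summable.of_nonneg_of_le (fun _ => norm_nonneg _)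
    (fun n => norm_tsum_le_tsum_norm (summable_norm_left hf n)) hf.prod_symm.prod

end SummableArrays

section Summation

variable {B : Type*} [NormedRing B] [CompleteSpace B]

theorem tsum_eq_tsum_tsum_left {f : ℕ → ℕ → B}
    (hf : Summable fun p : ℕ × ℕ => ‖f p.1 p.2‖) :
    ∑' p : ℕ × ℕ, f p.1 p.2 = ∑' n, ∑' m, f m n := by
  rw [← (Equiv.prodComm ℕ ℕ).tsum_eq]
  exact Summable.tsum_prod hf.of_norm.prod_symm

theorem hasSum_sum_range_mul {u v : ℕ → B} (hu : Summable fun n => ‖u n‖)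
    (hv : Summable fun n => ‖v n‖) :
    HasSum (fun n => ∑ i ∈ Finset.range (n + 1), u i * v (n - i)) ((∑' n, u n) * ∑' n, v n) := by
  rw [tsum_mul_tsum_eq_tsum_sum_range_of_summable_norm hu hv]
  exact (summable_norm_sum_mul_range_of_summable_norm hu hv).of_norm.hasSum

/-- The arrays `g` of moments and `κ` of cumulants satisfy the moment-cumulant recursion. -/
def ArrayRecursion (g κ : ℕ → ℕ → B) : Prop :=
  ∀ m n, ∑ i ∈ Finset.range (m + 1), g i 0 * κ (m - i) n +
    ∑ j ∈ Finset.range n, g m (j + 1) * κ 0 (n - (j + 1)) = if m + n = 0 then -1 else 0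

variable {g κ : ℕ → ℕ → B}

theorem ArrayRecursion.tsum_left_mul_tsum_left (hrec : ArrayRecursion g κ)
    (hg : Summable fun p : ℕ × ℕ => ‖g p.1 p.2‖) (hκ : Summable fun p : ℕ × ℕ => ‖κ p.1 p.2‖) :
    (∑' m, g m 0) * ∑' m, κ m 0 = -1 := by
  refine (hasSum_sum_range_mul (summable_norm_left hg 0) (summable_norm_left hκ 0)).unique ?_
  have h (m : ℕ) : ∑ i ∈ Finset.range (m + 1), g i 0 * κ (m - i) 0 = if m = 0 then -1 else 0 := by
    simpa using hrec m 0
  simp only [h]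
  exact hasSum_ite_eq 0 (-1)

theorem ArrayRecursion.tsum_right_mul_tsum_right (hrec : ArrayRecursion g κ)
    (hg : Summable fun p : ℕ × ℕ => ‖g p.1 p.2‖) (hκ : Summable fun p : ℕ × ℕ => ‖κ p.1 p.2‖) :
    (∑' n, g 0 n) * ∑' n, κ 0 n = -1 := by
  refine (hasSum_sum_range_mul (summable_norm_right hg 0) (summable_norm_right hκ 0)).unique ?_
  have h (n : ℕ) : ∑ j ∈ Finset.range (n + 1), g 0 j * κ 0 (n - j) = if n = 0 then -1 else 0 := by
    rw [Finset.sum_range_succ', add_comm]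
    simpa using hrec 0 n
  simp only [h]
  exact hasSum_ite_eq 0 (-1)

/-- Sum the recursion over `m`, then over `n`. First blocks inside the left part give a Cauchy
product in `m`. Those reaching the right part give a Cauchy product in `n` of the column sums of `g`
with `κ 0`, less its `j = 0` term. -/
theorem ArrayRecursion.tsum_left_mul_tsum_add (hrec : ArrayRecursion g κ)
    (hg : Summable fun p : ℕ × ℕ => ‖g p.1 p.2‖) (hκ : Summable fun p : ℕ × ℕ => ‖κ p.1 p.2‖) :
    (∑' m, g m 0) * (∑' p : ℕ × ℕ, κ p.1 p.2) +
      ((∑' p : ℕ × ℕ, g p.1 p.2) * (∑' n, κ 0 n) - (∑' m, g m 0) * ∑' n, κ 0 n) = -1 := by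
  have hcol (n : ℕ) : (∑' m, g m 0) * (∑' m, κ m n) +
      (∑ j ∈ Finset.range (n + 1), (∑' m, g m j) * κ 0 (n - j) - (∑' m, g m 0) * κ 0 n) =
        if n = 0 then -1 else 0 := by
    rw [Finset.sum_range_succ', Nat.sub_zero, add_sub_cancel_right]
    have h1 := hasSum_sum_range_mul (summable_norm_left hg 0) (summable_norm_left hκ n)
    have h2 : HasSum (fun m => ∑ j ∈ Finset.range n, g m (j + 1) * κ 0 (n - (j + 1)))
        (∑ j ∈ Finset.range n, (∑' m, g m (j + 1)) * κ 0 (n - (j + 1))) :=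
      hasSum_sum fun j _ => (summable_norm_left hg (j + 1)).of_norm.hasSum.mul_right _
    refine (h1.add h2).unique ?_
    simp only [hrec _ n]
    by_cases hn : n = 0
    · simp only [hn, add_zero, if_true]
      exact hasSum_ite_eq 0 (-1)
    · simp only [hn, add_eq_zero, and_false, if_false]
      exact hasSum_zero
  have h1 := (summable_norm_tsum_left hκ).of_norm.hasSum.mul_left (∑' m, g m 0)
  have h2 := hasSum_sum_range_mul (summable_norm_tsum_left hg) (summable_norm_right hκ 0)
  have h3 := (summable_norm_right hκ 0).of_norm.hasSum.mul_left (∑' m, g m 0)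
  rw [tsum_eq_tsum_tsum_left hκ, tsum_eq_tsum_tsum_left hg]
  refine (h1.add (h2.sub h3)).unique ?_
  simp only [hcol]
  exact hasSum_ite_eq 0 (-1)

theorem ArrayRecursion.tsum_eq (hrec : ArrayRecursion g κ)
    (hg : Summable fun p : ℕ × ℕ => ‖g p.1 p.2‖) (hκ : Summable fun p : ℕ × ℕ => ‖κ p.1 p.2‖)
    (hl : IsUnit (∑' m, g m 0)) (hr : IsUnit (∑' n, g 0 n)) :
    ∑' p : ℕ × ℕ, κ p.1 p.2 = ∑' m, κ m 0 + ∑' n, κ 0 n +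
      Ring.inverse (∑' m, g m 0) * (∑' p : ℕ × ℕ, g p.1 p.2) * Ring.inverse (∑' n, g 0 n) := by
  have h1 := hrec.tsum_left_mul_tsum_left hg hκ
  have h2 := hrec.tsum_right_mul_tsum_right hg hκ
  have h3 := hrec.tsum_left_mul_tsum_add hg hκ
  have hr' : ∑' n, κ 0 n = -Ring.inverse (∑' n, g 0 n) := by
    rw [← Ring.inverse_mul_cancel_left _ (∑' n, κ 0 n) hr, h2, mul_neg, mul_one]
  refine hl.mul_left_cancel ?_
  rw [mul_add, mul_add, h1, mul_assoc (Ring.inverse _), Ring.mul_inverse_cancel_left _ _ hl,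
    eq_sub_of_add_eq h3]
  -- This product cancels as it stands, so it is shielded from the substitution `hr'`.
  generalize (∑' m, g m 0) * ∑' n, κ 0 n = c
  rw [hr', mul_neg]
  abel

theorem tsum_eq_add_tsum_pairIndex {f : ℕ → ℕ → B}
    (hf : Summable fun p : ℕ × ℕ => ‖f p.1 p.2‖) :
    ∑' p : ℕ × ℕ, f p.1 p.2 = f 0 0 + ∑' p : PairIndex, f p.1.1 p.1.2 := by
  rw [← hf.of_norm.sum_add_tsum_subtype_compl {(0, 0)}, Finset.sum_singleton]
  congr 1
  refine (Equiv.subtypeEquivRight fun p => ?_).tsum_eq (fun p : PairIndex => f p.1.1 p.1.2)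
  rw [Finset.mem_singleton, Prod.ext_iff]
  simp only
  omega

end Summation

/-! ### Norm bounds -/

section Bounds

variable {B : Type*} [NormedRing B]

/-- Piece lengths add up, so the power of `t` is the same in every term; each position that may be
cut costs a factor `1 + K`. -/
theorem norm_chainSum_le {f : ℕ → ℕ → B} {N : ℕ} {K t : ℝ} (hK : 0 ≤ K) (ht : 0 ≤ t)
    (hf : ∀ p q, p ≤ q → q ≤ N → ‖f p q‖ ≤ K * t ^ (q - p)) (r : ℕ) :
    ∀ p k, p ≤ k → k + r = N → ‖chainSum f p k r‖ ≤ K * t ^ (N - p) * (1 + K) ^ r := by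
  induction r with
  | zero =>
    intro p k hpk hk
    obtain rfl : k = N := hk
    simpa [chainSum] using hf p k hpk le_rfl
  | succ r ih =>
    intro p k hpk hk
    have h1 := ih p (k + 1) (by omega) (by omega)
    have h2 := ih k (k + 1) (by omega) (by omega)
    have h3 := hf p k hpk (by omega)
    calc ‖chainSum f p k (r + 1)‖
        ≤ ‖chainSum f p (k + 1) r‖ + ‖f p k‖ * ‖chainSum f k (k + 1) r‖ :=
          (norm_sub_le _ _).trans (add_le_add_right (norm_mul_le _ _) _)
      _ ≤ K * t ^ (N - p) * (1 + K) ^ r +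
          K * t ^ (k - p) * (K * t ^ (N - k) * (1 + K) ^ r) := by gcongr
      _ = K * t ^ (N - p) * (1 + K) ^ (r + 1) := by
          rw [show N - p = (k - p) + (N - k) by omega, pow_add, pow_succ]
          ring

theorem norm_arrayCumulant_le {g : ℕ → ℕ → B} {K t : ℝ} (hK : 0 ≤ K) (ht : 0 ≤ t)
    (hg : ∀ i j, ‖g i j‖ ≤ K * t ^ (i + j)) (m n : ℕ) :
    ‖arrayCumulant g m n‖ ≤ (‖(1 : B)‖ + K) * ((1 + K) * t) ^ (m + n) := by
  unfold arrayCumulant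
  split_ifs with h
  · simpa [h] using hK
  · have hf : ∀ p q, p ≤ q → q ≤ m + n → ‖intervalMoment g m p q‖ ≤ K * t ^ (q - p) := by
      intro p q hpq _
      refine (hg _ _).trans_eq ?_
      congr 2
      omega
    refine (norm_chainSum_le hK ht hf _ 0 1 zero_le_one (by omega)).trans ?_
    rw [Nat.sub_zero, mul_pow, mul_comm ((1 + K) ^ _), ← mul_assoc]
    have h1 : (1 + K) ^ (m + n - 1) ≤ (1 + K) ^ (m + n) :=
      pow_le_pow_right₀ (by linarith) (Nat.sub_le _ _)
    have h2 : K ≤ ‖(1 : B)‖ + K := le_add_of_nonneg_left (norm_nonneg _)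
    gcongr

theorem summable_norm_of_le_geometric {f : ℕ → ℕ → B} {C r : ℝ} (hr0 : 0 ≤ r) (hr : r < 1)
    (hf : ∀ i j, ‖f i j‖ ≤ C * r ^ (i + j)) : Summable fun p : ℕ × ℕ => ‖f p.1 p.2‖ := by
  have h := summable_geometric_of_lt_one hr0 hr
  have h2 := (h.mul_of_nonneg h (fun n => pow_nonneg hr0 n) fun n => pow_nonneg hr0 n).mul_left C
  refine Summable.of_nonneg_of_le (fun _ => norm_nonneg _) (fun p => ?_) h2
  rw [← pow_add]
  exact hf p.1 p.2

/-- Neumann series: the tail has norm at most `K t / (1 - t)`, and this is below `1` exactly when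
`(1 + K) t < 1`. -/
theorem isUnit_one_add_tsum [CompleteSpace B] {f : ℕ → B} {K t : ℝ} (ht : 0 ≤ t)
    (ht1 : t < 1) (hKt : (1 + K) * t < 1) (hf : ∀ n, ‖f (n + 1)‖ ≤ K * t ^ (n + 1)) :
    IsUnit (1 + ∑' n, f (n + 1)) := by
  have h := (hasSum_geometric_of_lt_one ht ht1).mul_left (K * t)
  have h' : ‖∑' n, f (n + 1)‖ ≤ K * t * (1 - t)⁻¹ :=
    tsum_of_norm_bounded h fun n => (hf n).trans_eq (by ring)
  have h1 : K * t * (1 - t)⁻¹ < 1 := by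
    rw [← div_eq_mul_inv, div_lt_one (by linarith)]
    linarith
  rw [← sub_neg_eq_add]
  exact isUnit_one_sub_of_norm_lt_one (by rw [norm_neg]; exact h'.trans_lt h1)

end Bounds

namespace BBProbSpace

variable {A B : Type*} [Ring A] [Algebra ℂ A] [Ring B] [Algebra ℂ B]

theorem cumulantPair_eq_arrayCumulant (P : BBProbSpace A B) (Zl Zr : A) (b d : B) (m n : ℕ)
    (hmn : 1 ≤ m + n) :
    P.cumulantPair Zl Zr b d m n = arrayCumulant (P.momentPair Zl Zr b d) m n := by
  rw [P.cumulantPair_eq_chainSum Zl Zr b d m n hmn, arrayCumulant, if_neg (by omega)]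

theorem momentPair_zero (P : BBProbSpace A B) (Zl Zr : A) (b d : B) :
    P.momentPair Zl Zr b d 0 0 = 1 := by
  simp [momentPair, P.E_one]

end BBProbSpace

/-- The constant covers `n = 0`, since `‖1‖ = 1` is not assumed. -/
theorem norm_pow_le_one_add_mul {A : Type*} [NormedRing A] (x : A) {t : ℝ} (hx : ‖x‖ ≤ t)
    (n : ℕ) : ‖x ^ n‖ ≤ (1 + ‖(1 : A)‖) * t ^ n := by
  have ht : 0 ≤ t := (norm_nonneg x).trans hx
  have h1 := norm_nonneg (1 : A)
  rcases Nat.eq_zero_or_pos n with rfl | hn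
  · simp
  · refine ((norm_pow_le' x hn).trans (pow_le_pow_left₀ (norm_nonneg x) hx n)).trans ?_
    exact le_mul_of_one_le_left (pow_nonneg ht n) (by linarith)

namespace BanachBBProbSpace

variable {A B : Type*} [NormedRing A] [NormedAlgebra ℂ A] [CompleteSpace A]
  [NormedRing B] [NormedAlgebra ℂ B] [CompleteSpace B]

/-- The constant `K` must not depend on `t`, because `t` is later chosen in terms of `K`. -/
theorem exists_norm_momentPair_le (P : BanachBBProbSpace A B) :
    ∃ K : ℝ, 0 ≤ K ∧ ∀ (Zl Zr : A) (b d : B) (t : ℝ), ‖P.L b * Zl‖ ≤ t → ‖P.R d * Zr‖ ≤ t →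
      ∀ i j, ‖P.momentPair Zl Zr b d i j‖ ≤ K * t ^ (i + j) := by
  obtain ⟨C, hC⟩ := P.E_bounded
  refine ⟨|C| * ((1 + ‖(1 : A)‖) * (1 + ‖(1 : A)‖)), by positivity, fun Zl Zr b d t hl hr i j => ?_⟩
  have ht : 0 ≤ t := (norm_nonneg _).trans hl
  calc ‖P.momentPair Zl Zr b d i j‖
      ≤ C * ‖(P.L b * Zl) ^ i * (P.R d * Zr) ^ j‖ := hC _
    _ ≤ |C| * (‖(P.L b * Zl) ^ i‖ * ‖(P.R d * Zr) ^ j‖) :=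
        mul_le_mul (le_abs_self C) (norm_mul_le _ _) (norm_nonneg _) (abs_nonneg C)
    _ ≤ |C| * (((1 + ‖(1 : A)‖) * t ^ i) * ((1 + ‖(1 : A)‖) * t ^ j)) := by
        gcongr <;> exact norm_pow_le_one_add_mul _ (by assumption) _
    _ = _ := by ring

theorem exists_norm_mul_le (P : BanachBBProbSpace A B) (Zl Zr : A) {t : ℝ} (ht : 0 < t) :
    ∃ δ : ℝ, 0 < δ ∧ ∀ b d : B, ‖b‖ < δ → ‖d‖ < δ → ‖P.L b * Zl‖ ≤ t ∧ ‖P.R d * Zr‖ ≤ t := by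
  obtain ⟨C₁, hC₁⟩ := P.left_bounded
  obtain ⟨C₂, hC₂⟩ := P.right_bounded
  have hden : 0 < 1 + |C₁| * ‖Zl‖ + |C₂| * ‖Zr‖ := by positivity
  have key {C δ : ℝ} {x : B} {y z : A} (hy : ‖y‖ ≤ C * ‖x‖) (hx : ‖x‖ < δ) :
      ‖y * z‖ ≤ δ * (|C| * ‖z‖) := by
    have hδ : 0 ≤ δ := (norm_nonneg x).trans hx.le
    calc ‖y * z‖ ≤ ‖y‖ * ‖z‖ := norm_mul_le _ _
      _ ≤ (|C| * δ) * ‖z‖ := by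
        gcongr
        exact hy.trans (mul_le_mul (le_abs_self C) hx.le (norm_nonneg x) (abs_nonneg C))
      _ = _ := by ring
  have h1 : 0 ≤ |C₁| * ‖Zl‖ := by positivity
  have h2 : 0 ≤ |C₂| * ‖Zr‖ := by positivity
  -- One denominator serves both bounds; the summand `1` keeps it positive.
  refine ⟨t / (1 + |C₁| * ‖Zl‖ + |C₂| * ‖Zr‖), by positivity, fun b d hb hd => ⟨?_, ?_⟩⟩
  · refine (key (hC₁ b) hb).trans ?_
    rw [div_mul_eq_mul_div, div_le_iff₀ hden]
    exact mul_le_mul_of_nonneg_left (by linarith) ht.le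
  · refine (key (hC₂ d) hd).trans ?_
    rw [div_mul_eq_mul_div, div_le_iff₀ hden]
    exact mul_le_mul_of_nonneg_left (by linarith) ht.le

end BanachBBProbSpace

/-- The functional equation of the operator-valued bi-Boolean partial η-transform, together with
the absolute convergence of the six series and the invertibility that it presupposes. -/
theorem theorem8 {A B : Type*} [NormedRing A] [NormedAlgebra ℂ A] [CompleteSpace A]
    [NormedRing B] [NormedAlgebra ℂ B] [CompleteSpace B]
    (P : BanachBBProbSpace A B) (Zl Zr : A) (hl : Zl ∈ P.leftAlg) (hr : Zr ∈ P.rightAlg) :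
    ∃ δ : ℝ, 0 < δ ∧ ∀ b d : B, ‖b‖ < δ → ‖d‖ < δ →
      (Summable fun m : ℕ => ‖P.momentLeft Zl b (m + 1)‖) ∧
      (Summable fun n : ℕ => ‖P.momentRight Zr d (n + 1)‖) ∧
      (Summable fun p : PairIndex => ‖P.momentPair Zl Zr b d p.1.1 p.1.2‖) ∧
      (Summable fun m : ℕ => ‖P.cumulantLeft Zl b (m + 1)‖) ∧
      (Summable fun n : ℕ => ‖P.cumulantRight Zr d (n + 1)‖) ∧
      (Summable fun p : PairIndex => ‖P.cumulantPair Zl Zr b d p.1.1 p.1.2‖) ∧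
      IsUnit (P.MLeft Zl b) ∧
      IsUnit (P.MRight Zr d) ∧
      P.etaPair Zl Zr b d =
        P.etaLeft Zl b + P.etaRight Zr d +
          Ring.inverse (P.MLeft Zl b) * P.MPair Zl Zr b d * Ring.inverse (P.MRight Zr d) - 1 := by
  obtain ⟨K, hK, hbound⟩ := P.exists_norm_momentPair_le
  obtain ⟨t, ht, hKt⟩ : ∃ t : ℝ, 0 < t ∧ (1 + K) * t < 1 := by
    -- This makes the ratio `(1 + K) t` of the cumulant bound equal to `1/2`.
    refine ⟨(2 * (1 + K))⁻¹, by positivity, ?_⟩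
    rw [mul_inv, mul_left_comm, mul_inv_cancel₀ (by positivity)]
    norm_num
  obtain ⟨δ, hδ, hsmall⟩ := P.exists_norm_mul_le Zl Zr ht
  refine ⟨δ, hδ, fun b d hb hd => ?_⟩
  have ht1 : t < 1 := by nlinarith
  set g := P.momentPair Zl Zr b d with hgdef
  set κ := arrayCumulant g with hκdef
  have hgb := hbound Zl Zr b d t (hsmall b d hb hd).1 (hsmall b d hb hd).2
  rw [← hgdef] at hgb
  have hg0 : g 0 0 = 1 := P.momentPair_zero Zl Zr b d
  have hκ0 : κ 0 0 = -1 := if_pos rfl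
  have hg := summable_norm_of_le_geometric ht.le ht1 hgb
  have hκ := summable_norm_of_le_geometric (by positivity) hKt
    (norm_arrayCumulant_le hK ht.le hgb)
  rw [← hκdef] at hκ
  have hrec : ArrayRecursion g κ := sum_mul_arrayCumulant g hg0
  have hinj : Function.Injective fun n : ℕ => n + 1 := add_left_injective 1
  have emL (m : ℕ) : P.momentLeft Zl b m = g m 0 := P.momentLeft_eq_momentPair Zl Zr b d m
  have emR (n : ℕ) : P.momentRight Zr d n = g 0 n := P.momentRight_eq_momentPair Zl Zr b d n
  have ecP (m n : ℕ) (h : 1 ≤ m + n) : P.cumulantPair Zl Zr b d m n = κ m n :=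
    P.cumulantPair_eq_arrayCumulant Zl Zr b d m n h
  have ecL (m : ℕ) : P.cumulantLeft Zl b (m + 1) = κ (m + 1) 0 :=
    (P.cumulantLeft_eq_cumulantPair Zl Zr b d _).trans (ecP _ _ (by omega))
  have ecR (n : ℕ) : P.cumulantRight Zr d (n + 1) = κ 0 (n + 1) :=
    (P.cumulantRight_eq_cumulantPair Zl Zr b d _).trans (ecP _ _ (by omega))
  have ecI (p : PairIndex) : P.cumulantPair Zl Zr b d p.1.1 p.1.2 = κ p.1.1 p.1.2 :=
    ecP _ _ p.2
  have eMl : P.MLeft Zl b = ∑' m, g m 0 := by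
    rw [(summable_norm_left hg 0).of_norm.tsum_eq_zero_add, hg0, BanachBBProbSpace.MLeft]
    simp only [emL]
  have eMr : P.MRight Zr d = ∑' n, g 0 n := by
    rw [(summable_norm_right hg 0).of_norm.tsum_eq_zero_add, hg0, BanachBBProbSpace.MRight]
    simp only [emR]
  have eM : P.MPair Zl Zr b d = ∑' p : ℕ × ℕ, g p.1 p.2 := by
    rw [tsum_eq_add_tsum_pairIndex hg, hg0, BanachBBProbSpace.MPair]
  -- The `+ 1` here and in the next two identities compensates `κ 0 0 = -1`.
  have eηl : P.etaLeft Zl b = ∑' m, κ m 0 + 1 := by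
    rw [(summable_norm_left hκ 0).of_norm.tsum_eq_zero_add, hκ0, BanachBBProbSpace.etaLeft]
    simp only [ecL]
    abel
  have eηr : P.etaRight Zr d = ∑' n, κ 0 n + 1 := by
    rw [(summable_norm_right hκ 0).of_norm.tsum_eq_zero_add, hκ0, BanachBBProbSpace.etaRight]
    simp only [ecR]
    abel
  have eη : P.etaPair Zl Zr b d = ∑' p : ℕ × ℕ, κ p.1 p.2 + 1 := by
    rw [tsum_eq_add_tsum_pairIndex hκ, hκ0, BanachBBProbSpace.etaPair]
    simp only [ecI]
    abel
  have hul : IsUnit (P.MLeft Zl b) :=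
    isUnit_one_add_tsum ht.le ht1 hKt fun n => by rw [emL]; exact hgb (n + 1) 0
  have hur : IsUnit (P.MRight Zr d) :=
    isUnit_one_add_tsum ht.le ht1 hKt fun n => by
      rw [emR]
      simpa using hgb 0 (n + 1)
  refine ⟨?_, ?_, ?_, ?_, ?_, ?_, hul, hur, ?_⟩
  · simp only [emL]
    exact (summable_norm_left hg 0).comp_injective hinj
  · simp only [emR]
    exact (summable_norm_right hg 0).comp_injective hinj
  · exact hg.comp_injective Subtype.val_injective
  · simp only [ecL]
    exact (summable_norm_left hκ 0).comp_injective hinj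
  · simp only [ecR]
    exact (summable_norm_right hκ 0).comp_injective hinj
  · simp only [ecI]
    exact hκ.comp_injective Subtype.val_injective
  · rw [eMl] at hul ⊢
    rw [eMr] at hur ⊢
    rw [eη, eηl, eηr, eM, hrec.tsum_eq hg hκ hul hur]
    abel
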